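/- Let $R$ be a complete discrete valuation ring with normalized valuation $v$, field of fractions $K$ and finite residue field $k$ of characteristic $p$. Let $X/K$ be a non-singular irreducible projective variety of dimension $d$, and let $\mathcal{X}/R\subseteq\mathbb{P}^N_R$ be a smooth projective model of $X/K$, i.e. a closed subscheme that is smooth over $R$ and has generic fibre $X$. Let $\phi:\mathcal{X}\to\mathcal{X}$ be an $R$-morphism and let $P\in\mathcal{X}(R)$ be a periodic point of primitive period $n$ for $\phi$. Let $\overline{\phi}$ and $\overline{P}$ be the restrictions of $\phi$ and $P$ to the special fibre $\mathcal{X}\times_R\operatorname{Spec}k$, and let $m$ be the primitive period of $\overline{P}$ for $\overline{\phi}$. Let $\mathcal{V}\subseteq\mathcal{X}$ be the scheme-theoretic union of the sections $P,\phi(P),\dots,\phi^{n-1}(P)$, let $V$ be the cotangent space of $\mathcal{V}\times_R\operatorname{Spec}k$ at $\overline{P}$, and let $r_V$ be the order of the linear map induced on $V$ by $\overline{\phi^m}$. Then there is an integer $e\ge 0$ with $$n=m\,r_V\,p^e,$$ and this exponent satisfies $$e\le\begin{cases}1+\log_2 v(p) & \text{if } p\ne 2,\\[1mm] 1+\log_\alpha\!\left(\dfrac{\sqrt5\,v(2)+\sqrt{5\,v(2)^2+4}}{2}\right)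 & \text{if } p=2,\end{cases}\qquad \alpha=\frac{1+\sqrt5}{2}.$$ (If $p=0$ in $R$, then $v(p)=\infty$ and the bound is void.) -/

import Mathlib

universe u

open CategoryTheory CategoryTheory.Limits AlgebraicGeometry

noncomputable section

namespace GoodReduction

attribute [local instance] MvPolynomial.gradedAlgebra

/-- Projective space of relative dimension `N` over `R`: `Proj R[t_0, …, t_N]`. -/
abbrev projectiveSpace (R : Type u) [CommRing R] (N : ℕ) : Scheme.{u} :=
  Proj (MvPolynomial.homogeneousSubmodule (Fin (N + 1)) R)

/-- The structure morphism of projective space over `R`. -/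
def projectiveSpaceToSpec (R : Type u) [CommRing R] (N : ℕ) :
    projectiveSpace R N ⟶ Spec (.of R) :=
  Proj.toSpecZero (MvPolynomial.homogeneousSubmodule (Fin (N + 1)) R) ≫
    Spec.map (CommRingCat.ofHom
      (algebraMap R (MvPolynomial.homogeneousSubmodule (Fin (N + 1)) R 0)))

/-- The `i`-th iterate `φ^i(P) = φ ∘ ⋯ ∘ φ ∘ P` of a `T`-valued point `P` of `X` under an
endomorphism `φ` of `X`. -/
def iteratePoint {X T : Scheme.{u}} (φ : X ⟶ X) (P : T ⟶ X) (i : ℕ) : T ⟶ X :=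
  (fun Q : T ⟶ X => Q ≫ φ)^[i] P

/-- The `i`-th iterate `φ^i` of an endomorphism of a scheme. -/
def iterateHom {X : Scheme.{u}} (φ : X ⟶ X) (i : ℕ) : X ⟶ X :=
  iteratePoint φ (𝟙 X) i

/-- The primitive period of a `T`-valued point `P` of `X` under `φ`: the least `n > 0` with
`φ^n(P) = P` if `P` is periodic, and `0` if `P` is not periodic. -/
def primitivePeriod {X T : Scheme.{u}} (φ : X ⟶ X) (P : T ⟶ X) : ℕ :=
  Function.minimalPeriod (fun Q : T ⟶ X => Q ≫ φ) P

lemma iteratePoint_succ {X T : Scheme.{u}} (φ : X ⟶ X) (P : T ⟶ X) (i : ℕ) :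
    iteratePoint φ P (i + 1) = iteratePoint φ P i ≫ φ :=
  Function.iterate_succ_apply' _ _ _

lemma comp_iterateHom {X T : Scheme.{u}} (φ : X ⟶ X) (P : T ⟶ X) (i : ℕ) :
    P ≫ iterateHom φ i = iteratePoint φ P i := by
  induction i with
  | zero => exact Category.comp_id P
  | succ i ih =>
    rw [iterateHom, iteratePoint_succ, iteratePoint_succ, ← ih, ← Category.assoc]
    rfl

section Orbit

variable {R : Type u} [CommRing R] {X : Scheme.{u}}

/-- The ideal sheaf of the scheme-theoretic union of the sections `P, φ(P), φ²(P), …`, i.e. the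
intersection of their ideal sheaves. If `P` has primitive period `n > 0`, these
sections are exactly `P, φ(P), …, φ^{n-1}(P)`. -/
def orbitIdeal (φ : X ⟶ X) (P : Spec (.of R) ⟶ X) : X.IdealSheafData :=
  ⨅ i : ℕ, (iteratePoint φ P i).ker

/-- The scheme-theoretic union `𝒱 ⊆ X` of the sections in the orbit of `P`. -/
abbrev orbitScheme (φ : X ⟶ X) (P : Spec (.of R) ⟶ X) : Scheme.{u} :=
  (orbitIdeal φ P).subscheme

/-- The closed immersion `𝒱 ⟶ X`. -/
abbrev orbitInclusion (φ : X ⟶ X) (P : Spec (.of R) ⟶ X) : orbitScheme φ P ⟶ X :=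
  (orbitIdeal φ P).subschemeι

lemma orbitIdeal_le_map (φ : X ⟶ X) (P : Spec (.of R) ⟶ X) :
    orbitIdeal φ P ≤ (orbitIdeal φ P).map φ := by
  have h : (orbitIdeal φ P).map φ = ⨅ i : ℕ, ((iteratePoint φ P i).ker).map φ :=
    (Scheme.IdealSheafData.map_gc φ).u_iInf
  rw [h]
  refine le_iInf fun i => ?_
  rw [Scheme.IdealSheafData.map_ker, ← iteratePoint_succ]
  exact iInf_le _ (i + 1)

/-- The endomorphism of `𝒱` induced by `φ`. -/
def orbitMap (φ : X ⟶ X) (P : Spec (.of R) ⟶ X) : orbitScheme φ P ⟶ orbitScheme φ P :=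
  Scheme.IdealSheafData.subschemeMap _ _ φ (orbitIdeal_le_map φ P)

lemma orbitMap_inclusion (φ : X ⟶ X) (P : Spec (.of R) ⟶ X) :
    orbitMap φ P ≫ orbitInclusion φ P = orbitInclusion φ P ≫ φ :=
  Scheme.IdealSheafData.subschemeMap_subschemeι _ _ _ _

/-- The section `P`, seen as a section of `𝒱`. -/
def orbitPoint (φ : X ⟶ X) (P : Spec (.of R) ⟶ X) : Spec (.of R) ⟶ orbitScheme φ P :=
  IsClosedImmersion.lift (orbitIdeal φ P).subschemeι P <| by
    rw [Scheme.IdealSheafData.ker_subschemeι]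
    exact iInf_le (fun i : ℕ => (iteratePoint φ P i).ker) 0

lemma orbitPoint_inclusion (φ : X ⟶ X) (P : Spec (.of R) ⟶ X) :
    orbitPoint φ P ≫ orbitInclusion φ P = P :=
  IsClosedImmersion.lift_fac _ _ _

/-- The structure morphism `𝒱 ⟶ Spec R`. -/
def orbitToSpec (f : X ⟶ Spec (.of R)) (φ : X ⟶ X) (P : Spec (.of R) ⟶ X) :
    orbitScheme φ P ⟶ Spec (.of R) :=
  orbitInclusion φ P ≫ f

lemma orbitInclusion_toSpec (f : X ⟶ Spec (.of R)) (φ : X ⟶ X) (P : Spec (.of R) ⟶ X) :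
    orbitInclusion φ P ≫ f = orbitToSpec f φ P :=
  rfl

lemma orbitMap_toSpec (f : X ⟶ Spec (.of R)) (φ : X ⟶ X) (hφ : φ ≫ f = f)
    (P : Spec (.of R) ⟶ X) : orbitMap φ P ≫ orbitToSpec f φ P = orbitToSpec f φ P := by
  rw [orbitToSpec, ← Category.assoc, orbitMap_inclusion, Category.assoc, hφ]

lemma orbitPoint_toSpec (f : X ⟶ Spec (.of R)) (φ : X ⟶ X)
    (P : Spec (.of R) ⟶ X) (hP : P ≫ f = 𝟙 _) :
    orbitPoint φ P ≫ orbitToSpec f φ P = 𝟙 _ := by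
  rw [orbitToSpec, ← Category.assoc, orbitPoint_inclusion, hP]

end Orbit

section SpecialFibre

variable {R : Type u} [CommRing R] [IsLocalRing R] {X Y : Scheme.{u}}

/-- The closed immersion `Spec k ⟶ Spec R`, where `k` is the residue field of `R`. -/
def specResidue (R : Type u) [CommRing R] [IsLocalRing R] :
    Spec (.of (IsLocalRing.ResidueField R)) ⟶ Spec (.of R) :=
  Spec.map (CommRingCat.ofHom (IsLocalRing.residue R))

/-- The special fibre `X ×_R Spec k` of an `R`-scheme `f : X ⟶ Spec R`. -/
def specialFibre (f : X ⟶ Spec (.of R)) : Scheme.{u} :=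
  pullback f (specResidue R)

/-- The projection `X ×_R Spec k ⟶ X`. -/
def specialFibreFst (f : X ⟶ Spec (.of R)) : specialFibre f ⟶ X :=
  pullback.fst f (specResidue R)

/-- The projection `X ×_R Spec k ⟶ Spec k`. -/
def specialFibreSnd (f : X ⟶ Spec (.of R)) :
    specialFibre f ⟶ Spec (.of (IsLocalRing.ResidueField R)) :=
  pullback.snd f (specResidue R)

lemma isPullback_specialFibre (f : X ⟶ Spec (.of R)) :
    IsPullback (specialFibreFst f) (specialFibreSnd f) f (specResidue R) :=
  IsPullback.of_hasPullback f (specResidue R)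

/-- The restriction to the special fibres of a morphism of `R`-schemes. -/
def specialFibreMap (f : X ⟶ Spec (.of R)) (g : Y ⟶ Spec (.of R)) (φ : X ⟶ Y)
    (hφ : φ ≫ g = f) : specialFibre f ⟶ specialFibre g :=
  (isPullback_specialFibre g).lift (specialFibreFst f ≫ φ) (specialFibreSnd f) (by
    rw [Category.assoc, hφ, (isPullback_specialFibre f).w])

/-- The reduction of a section `P ∈ X(R)`, a `k`-valued point of the special fibre. -/
def reduction (f : X ⟶ Spec (.of R)) (P : Spec (.of R) ⟶ X) (hP : P ≫ f = 𝟙 _) :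
    Spec (.of (IsLocalRing.ResidueField R)) ⟶ specialFibre f :=
  (isPullback_specialFibre f).lift (specResidue R ≫ P) (𝟙 _) (by
    rw [Category.assoc, hP, Category.comp_id, Category.id_comp])

lemma specialFibreMap_fst (f : X ⟶ Spec (.of R)) (g : Y ⟶ Spec (.of R)) (φ : X ⟶ Y)
    (hφ : φ ≫ g = f) :
    specialFibreMap f g φ hφ ≫ specialFibreFst g = specialFibreFst f ≫ φ :=
  (isPullback_specialFibre g).lift_fst _ _ _

lemma specialFibreMap_snd (f : X ⟶ Spec (.of R)) (g : Y ⟶ Spec (.of R)) (φ : X ⟶ Y)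
    (hφ : φ ≫ g = f) :
    specialFibreMap f g φ hφ ≫ specialFibreSnd g = specialFibreSnd f :=
  (isPullback_specialFibre g).lift_snd _ _ _

lemma specialFibreMap_comp {Z : Scheme.{u}} (f : X ⟶ Spec (.of R)) (g : Y ⟶ Spec (.of R))
    (h : Z ⟶ Spec (.of R)) (φ : X ⟶ Y) (hφ : φ ≫ g = f) (ψ : Y ⟶ Z) (hψ : ψ ≫ h = g) :
    specialFibreMap f g φ hφ ≫ specialFibreMap g h ψ hψ =
      specialFibreMap f h (φ ≫ ψ) (by rw [Category.assoc, hψ, hφ]) := by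
  apply (isPullback_specialFibre h).hom_ext
  · rw [Category.assoc, specialFibreMap_fst, ← Category.assoc, specialFibreMap_fst,
      Category.assoc, specialFibreMap_fst]
  · rw [Category.assoc, specialFibreMap_snd, specialFibreMap_snd, specialFibreMap_snd]

lemma reduction_fst (f : X ⟶ Spec (.of R)) (P : Spec (.of R) ⟶ X) (hP : P ≫ f = 𝟙 _) :
    reduction f P hP ≫ specialFibreFst f = specResidue R ≫ P :=
  (isPullback_specialFibre f).lift_fst _ _ _

lemma reduction_snd (f : X ⟶ Spec (.of R)) (P : Spec (.of R) ⟶ X) (hP : P ≫ f = 𝟙 _) :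
    reduction f P hP ≫ specialFibreSnd f = 𝟙 _ :=
  (isPullback_specialFibre f).lift_snd _ _ _

lemma reduction_specialFibreMap (f : X ⟶ Spec (.of R)) (g : Y ⟶ Spec (.of R)) (φ : X ⟶ Y)
    (hφ : φ ≫ g = f) (P : Spec (.of R) ⟶ X) (hP : P ≫ f = 𝟙 _) :
    reduction f P hP ≫ specialFibreMap f g φ hφ =
      reduction g (P ≫ φ) (by rw [Category.assoc, hφ, hP]) := by
  apply (isPullback_specialFibre g).hom_ext
  · rw [Category.assoc, specialFibreMap_fst, reduction_fst, ← Category.assoc, reduction_fst,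
      Category.assoc]
  · rw [Category.assoc, specialFibreMap_snd, reduction_snd, reduction_snd]

end SpecialFibre

/-- The local ring homomorphism `𝒪_{Y,x} ⟶ 𝒪_{Y,x}` induced by an endomorphism `g` of `Y` that
fixes `x`. -/
def stalkEndo {Y : Scheme.{u}} (g : Y ⟶ Y) (x : Y) (hx : g x = x) :
    Y.presheaf.stalk x ⟶ Y.presheaf.stalk x :=
  (Y.presheaf.stalkCongr (.of_eq hx)).inv ≫ g.stalkMap x

lemma stalkEndo_maximalIdeal {Y : Scheme.{u}} (g : Y ⟶ Y) (x : Y) (hx : g x = x) :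
    IsLocalRing.maximalIdeal (Y.presheaf.stalk x) ≤
      (IsLocalRing.maximalIdeal (Y.presheaf.stalk x)).comap (stalkEndo g x hx).hom := by
  have h : IsLocalHom (stalkEndo g x hx).hom := by
    rw [stalkEndo]
    infer_instance
  exact ((IsLocalRing.local_hom_TFAE (stalkEndo g x hx).hom).out 0 3).mp h

/-- The linear map induced on the cotangent space `𝔪_x/𝔪_x²` of `Y` at `x` by an endomorphism
`g` of `Y` that fixes `x`. (Only its order matters below, so it is recorded as an additive map.) -/
def cotangentMap {Y : Scheme.{u}} (g : Y ⟶ Y) (x : Y) (hx : g x = x) :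
    Module.End ℤ (IsLocalRing.CotangentSpace (Y.presheaf.stalk x)) :=
  Ideal.mapCotangent _ _ (stalkEndo g x hx).hom.toIntAlgHom (stalkEndo_maximalIdeal g x hx)

section Cotangent

variable {R : Type u} [CommRing R] [IsLocalRing R] {X : Scheme.{u}}

/-- The primitive period of the reduction of `P` under the reduction of `φ`. -/
def reducedPeriod (f : X ⟶ Spec (.of R)) (φ : X ⟶ X) (hφ : φ ≫ f = f)
    (P : Spec (.of R) ⟶ X) (hP : P ≫ f = 𝟙 _) : ℕ :=
  primitivePeriod (specialFibreMap f f φ hφ) (reduction f P hP)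

/-- The special fibre `𝒱 ×_R Spec k` of the union of the orbit. -/
abbrev orbitSpecialFibre (f : X ⟶ Spec (.of R)) (φ : X ⟶ X) (P : Spec (.of R) ⟶ X) :
    Scheme.{u} :=
  specialFibre (orbitToSpec f φ P)

/-- The endomorphism of `𝒱 ×_R Spec k` induced by `φ`. -/
def orbitSpecialMap (f : X ⟶ Spec (.of R)) (φ : X ⟶ X) (hφ : φ ≫ f = f)
    (P : Spec (.of R) ⟶ X) : orbitSpecialFibre f φ P ⟶ orbitSpecialFibre f φ P :=
  specialFibreMap _ _ (orbitMap φ P) (orbitMap_toSpec f φ hφ P)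

/-- The reduction of `P`, as a `k`-valued point of `𝒱 ×_R Spec k`. -/
def orbitReduction (f : X ⟶ Spec (.of R)) (φ : X ⟶ X) (P : Spec (.of R) ⟶ X)
    (hP : P ≫ f = 𝟙 _) :
    Spec (.of (IsLocalRing.ResidueField R)) ⟶ orbitSpecialFibre f φ P :=
  reduction _ (orbitPoint φ P) (orbitPoint_toSpec f φ P hP)

/-- The reduction of `P`, as a point of the scheme `𝒱 ×_R Spec k`. -/
def orbitReducedPoint (f : X ⟶ Spec (.of R)) (φ : X ⟶ X) (P : Spec (.of R) ⟶ X)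
    (hP : P ≫ f = 𝟙 _) : orbitSpecialFibre f φ P :=
  orbitReduction f φ P hP
    (IsLocalRing.closedPoint (IsLocalRing.ResidueField R))

/-- The restriction of `φ^m` to `𝒱 ×_R Spec k`, where `m` is the primitive period of the
reduction of `P`. -/
def orbitReturnMap (f : X ⟶ Spec (.of R)) (φ : X ⟶ X) (hφ : φ ≫ f = f)
    (P : Spec (.of R) ⟶ X) (hP : P ≫ f = 𝟙 _) :
    orbitSpecialFibre f φ P ⟶ orbitSpecialFibre f φ P :=
  iterateHom (orbitSpecialMap f φ hφ P) (reducedPeriod f φ hφ P hP)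

lemma orbitReduction_returnMap (f : X ⟶ Spec (.of R)) (φ : X ⟶ X) (hφ : φ ≫ f = f)
    (P : Spec (.of R) ⟶ X) (hP : P ≫ f = 𝟙 _) :
    orbitReduction f φ P hP ≫ orbitReturnMap f φ hφ P hP = orbitReduction f φ P hP := by
  let j : orbitSpecialFibre f φ P ⟶ specialFibre f :=
    specialFibreMap (orbitToSpec f φ P) f (orbitInclusion φ P) (orbitInclusion_toSpec f φ P)
  have hj : Mono j := by
    constructor
    intro Z a b hab
    apply (isPullback_specialFibre (orbitToSpec f φ P)).hom_ext
    · rw [← cancel_mono (orbitInclusion φ P), Category.assoc, Category.assoc,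
        ← specialFibreMap_fst (orbitToSpec f φ P) f (orbitInclusion φ P) (orbitInclusion_toSpec f φ P),
        ← Category.assoc, ← Category.assoc]
      exact congr($hab ≫ specialFibreFst f)
    · rw [← specialFibreMap_snd (orbitToSpec f φ P) f (orbitInclusion φ P) (orbitInclusion_toSpec f φ P),
        ← Category.assoc, ← Category.assoc]
      exact congr($hab ≫ specialFibreSnd f)
  have hQ : orbitReduction f φ P hP ≫ j = reduction f P hP := by
    refine (reduction_specialFibreMap _ _ _ _ _ _).trans ?_
    simp only [orbitPoint_inclusion]
  have hcomm : orbitSpecialMap f φ hφ P ≫ j = j ≫ specialFibreMap f f φ hφ := by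
    refine (specialFibreMap_comp _ _ _ _ _ _ _).trans
      (Eq.trans ?_ (specialFibreMap_comp _ _ _ _ _ _ _).symm)
    simp only [orbitMap_inclusion]
  have key : ∀ i : ℕ, iteratePoint (orbitSpecialMap f φ hφ P) (orbitReduction f φ P hP) i ≫ j =
      iteratePoint (specialFibreMap f f φ hφ) (reduction f P hP) i := by
    intro i
    induction i with
    | zero => exact hQ
    | succ i ih =>
      rw [iteratePoint_succ, iteratePoint_succ, ← ih, Category.assoc, hcomm, Category.assoc]
  rw [orbitReturnMap, comp_iterateHom, ← cancel_mono j, key, hQ]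
  exact Function.iterate_minimalPeriod

lemma orbitReturnMap_reducedPoint (f : X ⟶ Spec (.of R)) (φ : X ⟶ X) (hφ : φ ≫ f = f)
    (P : Spec (.of R) ⟶ X) (hP : P ≫ f = 𝟙 _) :
    orbitReturnMap f φ hφ P hP (orbitReducedPoint f φ P hP) = orbitReducedPoint f φ P hP := by
  have h := congr($(orbitReduction_returnMap f φ hφ P hP)
    (IsLocalRing.closedPoint (IsLocalRing.ResidueField R)))
  exact h

/-- The cotangent space `V` of `𝒱 ×_R Spec k` at the reduction of `P`. -/
abbrev orbitCotangentSpace (f : X ⟶ Spec (.of R)) (φ : X ⟶ X)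
    (P : Spec (.of R) ⟶ X) (hP : P ≫ f = 𝟙 _) : Type u :=
  IsLocalRing.CotangentSpace
    ((orbitSpecialFibre f φ P).presheaf.stalk (orbitReducedPoint f φ P hP))

/-- The map induced on `V` by the reduction of `φ^m`, where `m` is the primitive period of the
reduction of `P`. -/
def orbitCotangentMap (f : X ⟶ Spec (.of R)) (φ : X ⟶ X) (hφ : φ ≫ f = f)
    (P : Spec (.of R) ⟶ X) (hP : P ≫ f = 𝟙 _) :
    Module.End ℤ (orbitCotangentSpace f φ P hP) :=
  cotangentMap (orbitReturnMap f φ hφ P hP) (orbitReducedPoint f φ P hP)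
    (orbitReturnMap_reducedPoint f φ hφ P hP)

/-- The number `r_V`: the order of the map induced on `V` by the reduction of `φ^m`. -/
def cotangentOrder (f : X ⟶ Spec (.of R)) (φ : X ⟶ X) (hφ : φ ≫ f = f)
    (P : Spec (.of R) ⟶ X) (hP : P ≫ f = 𝟙 _) : ℕ :=
  orderOf (orbitCotangentMap f φ hφ P hP)

end Cotangent

end GoodReduction

end

/-!
The period `n` of `P` splits into three factors. The reduction of `P` has period `m`, a divisor of
`n`. The map `φ ^ n` fixes every section in the orbit, hence is the identity on their union `𝒱`
(`orbitInclusion_comp_eq_of_forall`, where separatedness of `𝒳` enters), so the order `r` of the map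
induced on the cotangent space `V` divides `n / m`. What remains is to study `N = n / (m r)`, the
period of `P` under `φ ^ (m r)`, and this happens in the local ring `A` of `𝒱` at the closed point
of `P`.

The section `P` is a retraction `ε : A → R` with kernel `I`, and `φ ^ (m r)` induces an `R`-algebra
endomorphism `σ` of `A` for which the points of the orbit are the `ε ∘ σ ^ k`. The kernel of the
surjection from `A` to the local ring of the special fibre is `π A`, where `π` is a uniformizer
(`ker_stalkHom_specialFibreFst_le`), so triviality on `V` means that `σ` is the identity on the
maximal ideal `I + π A` modulo its square and `π A` (`exists_isCloseToId`). In terms of coordinates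
centred at `P`, the map is `x ↦ c + (1 + Λ) x + O(x²)` with `c` and `Λ` divisible by `π`. The
predicate `IsCloseToId` records, without coordinates, that `π ^ d ∣ c` and `π ^ l ∣ Λ`.

Let `δ = σ - 1` and let `q` be a prime. In `σ ^ q = (1 + δ) ^ q` all terms but `1` and `δ ^ q` are
divisible by `q`, and repeated application of `δ` gains powers of `π` along the ideals
`π ^ c I + I² + π ^ d A`. Two facts follow.

* If `ε` has exact period `q` under `σ`, then `min ((q - 1) l) d ≤ v(q)`
  (`IsCloseToId.le_of_pow_prime`). For `q ≠ p` the right side is `0`, while `d, l ≥ 1`. So `N` is a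
  power `p ^ e`.
* If `π ^ v ∣ q`, then `σ ^ q` satisfies the same conditions with
  `d' = d + min v ((q - 1) l) d` and `l' = min (v + l) (q l) d` (`IsCloseToId.pow_prime`).

Starting from `d = l = 1`, the second fact for `q = p` makes the exponents of `σ ^ (p ^ k)` grow: for
odd `p`, `d` and `2 l` reach `2 ^ k`, and for `p = 2`, `d` and `l` reach the Fibonacci numbers
`F (k + 2)` and `F (k + 1)`, as long as these do not exceed `v(p)`. The first fact, applied to
`σ ^ (p ^ (e - 1))`, gives `2 ^ (e - 1) ≤ v(p)` for odd `p` and `F e ≤ v(2)` for `p = 2`. Taking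
logarithms gives the stated bounds.
-/

noncomputable section

namespace GoodReduction

/-! ### Algebra endomorphisms close to the identity at a point -/

section Core
open Polynomial
variable {R A : Type*} [CommRing R] [CommRing A] [Algebra R A]

/-- The ideal `π ^ c • I + I² + (π ^ d)` of `A`, where `I` is the kernel of the point `ε`. It
measures how far, modulo `I²` and `π ^ d`, an element is from vanishing at `ε`. -/
def idealFiltration (ε : A →ₐ[R] R) (π : R) (d c : ℕ) : Ideal A :=
  Ideal.span {algebraMap R A π ^ c} * RingHom.ker ε ⊔ RingHom.ker ε ^ 2 ⊔
    Ideal.span {algebraMap R A π ^ d}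

/-- The difference operator `σ - 1` of an endomorphism `σ`; it is `R`-linear, not multiplicative. -/
def displacement (σ : A →ₐ[R] A) : Module.End R A := σ.toLinearMap - 1

/-- The endomorphism `σ` is close to the identity at the `R`-valued point `ε`, with kernel `I`:
it moves the point `ε` by a multiple of `π ^ d`, and its derivative at `ε`, read off on `I / I²`, is
congruent to `1` modulo `π ^ l`. -/
structure IsCloseToId (ε : A →ₐ[R] R) (π : R) (σ : A →ₐ[R] A) (d l : ℕ) : Prop where
  dvd_eval : ∀ y, ε y = 0 → π ^ d ∣ ε (σ y)
  linear_part : ∀ y, ε y = 0 → σ y - y - algebraMap R A (ε (σ y)) ∈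
    Ideal.span {algebraMap R A π ^ l} * RingHom.ker ε ⊔ RingHom.ker ε ^ 2

lemma displacement_apply (σ : A →ₐ[R] A) (y : A) : displacement σ y = σ y - y := rfl

/-- Powers of `σ` are powers of `1 + δ`, `δ` the displacement operator, and so obey the binomial
theorem. -/
lemma displacement_pow_apply (σ : A →ₐ[R] A) (n : ℕ) (y : A) :
    ((1 + displacement σ) ^ n) y = (σ ^ n) y := by
  have : (1 + displacement σ) = σ.toLinearMap := by simp [displacement]
  rw [this, Module.End.pow_apply, AlgHom.coe_pow]
  rfl

lemma mem_idealFiltration {ε : A →ₐ[R] R} {π : R} {d c : ℕ} {z : A} :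
    z ∈ idealFiltration ε π d c ↔ ∃ y s w, ε y = 0 ∧ s ∈ RingHom.ker ε ^ 2 ∧
      z = algebraMap R A (π ^ c) * y + s + algebraMap R A (π ^ d) * w := by
  simp only [idealFiltration, Submodule.mem_sup, Ideal.mem_span_singleton_mul,
    Ideal.mem_span_singleton', RingHom.mem_ker, map_pow]
  constructor
  · rintro ⟨_, ⟨_, ⟨y, hy, rfl⟩, s, hs, rfl⟩, _, ⟨w, rfl⟩, rfl⟩
    exact ⟨y, s, w, hy, hs, by ring⟩
  · rintro ⟨y, s, w, hy, hs, rfl⟩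
    exact ⟨_, ⟨_, ⟨y, hy, rfl⟩, s, hs, rfl⟩, _, ⟨w, rfl⟩, by ring⟩

lemma sup_sq_le (I J : Ideal A) : (I ⊔ J) ^ 2 ≤ I ^ 2 ⊔ J := by
  rw [sq, Ideal.sup_mul, Ideal.mul_sup, sq]
  exact sup_le (sup_le le_sup_left (le_sup_of_le_right Ideal.mul_le_right))
    (le_sup_of_le_right Ideal.mul_le_left)

/-- The binomial theorem at a prime `q`: the middle terms are divisible by `q`, and `X` is the only
term among them that is not divisible by `q X²`. -/
lemma exists_one_add_pow_prime (q : ℕ) (hq : q.Prime) :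
    ∃ s : ℤ[X], (1 + X : ℤ[X]) ^ q = 1 + (q : ℤ[X]) * (X * (1 + X * s)) + X ^ q := by
  obtain ⟨r, hr⟩ := exists_add_pow_prime_eq hq (1 : ℤ[X]) X
  have h1 : r.coeff 0 = 1 := by
    have h := congr($hr |>.coeff 1)
    have hq1 : 1 ≠ q := hq.one_lt.ne
    rw [coeff_one_add_X_pow] at h
    have : ((q : ℤ[X]) * 1 * X * r).coeff 1 = q * r.coeff 0 := by
      rw [show (q : ℤ[X]) * 1 * X * r = (q : ℤ[X]) * (r * X) by ring, ← C_eq_natCast, coeff_C_mul,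
        coeff_mul_X]
    rw [one_pow, coeff_add, coeff_add, this, coeff_X_pow, coeff_one] at h
    have hq0 : (q : ℤ) ≠ 0 := by exact_mod_cast hq.ne_zero
    simp only [Nat.choose_one_right, one_ne_zero, hq1, if_false, zero_add] at h
    exact (mul_right_eq_self₀.mp h.symm).resolve_right hq0
  obtain ⟨s, hs⟩ : X ∣ r - 1 := by
    rw [X_dvd_iff]; simp [h1]
  refine ⟨s, ?_⟩
  rw [hr, ← hs]; ring

lemma exists_one_add_pow_prime_end {M : Type*} [Ring M] (δ : M) (q : ℕ) (hq : q.Prime) :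
    ∃ s : M, (1 + δ) ^ q = 1 + q * (δ * (1 + δ * s)) + δ ^ q := by
  obtain ⟨s, hs⟩ := exists_one_add_pow_prime q hq
  refine ⟨aeval δ s, ?_⟩
  simpa using congr(aeval δ $hs)

variable {ε : A →ₐ[R] R} {π : R} {σ : A →ₐ[R] A} {d l : ℕ}

lemma eval_sub_algebraMap_eval (ε : A →ₐ[R] R) (w : A) : ε (w - algebraMap R A (ε w)) = 0 := by
  simp

lemma displacement_sub_algebraMap (w : A) (r : R) :
    displacement σ (w - algebraMap R A r) = displacement σ w := by
  simp [displacement_apply]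

/-- The expansion of `σ ^ q` in powers of the displacement operator, with the terms of degree
between `1` and `q - 1` collected into one. -/
lemma exists_pow_prime_apply (σ : A →ₐ[R] A) {q : ℕ} (hq : q.Prime) (y : A) :
    ∃ w, (σ ^ q) y = y + q * (displacement σ (y + displacement σ w)) + (displacement σ ^ q) y := by
  obtain ⟨s, hs⟩ := exists_one_add_pow_prime_end (displacement σ) q hq
  refine ⟨s y, ?_⟩
  rw [← displacement_pow_apply, hs]
  simp [Module.End.mul_apply, Module.End.natCast_apply, mul_add]

lemma idealFiltration_mono {c c' : ℕ} (hc : c' ≤ c) :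
    idealFiltration ε π d c ≤ idealFiltration ε π d c' :=
  sup_le_sup_right (sup_le_sup_right (Ideal.mul_mono_left
    (Ideal.span_singleton_le_span_singleton.mpr (pow_dvd_pow _ hc))) _) _

namespace IsCloseToId

lemma dvd_eval_displacement (h : IsCloseToId ε π σ d l) (w : A) :
    π ^ d ∣ ε (displacement σ w) := by
  rw [← displacement_sub_algebraMap w (ε w)]
  have := h.dvd_eval _ (eval_sub_algebraMap_eval ε w)
  rwa [displacement_apply, map_sub, eval_sub_algebraMap_eval, sub_zero]

lemma displacement_mem (h : IsCloseToId ε π σ d l) (w : A) :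
    displacement σ w ∈ idealFiltration ε π d l := by
  rw [← displacement_sub_algebraMap w (ε w)]
  have hw := eval_sub_algebraMap_eval ε w
  set y := w - algebraMap R A (ε w)
  obtain ⟨r, hr⟩ := h.dvd_eval y hw
  have := h.linear_part y hw
  rw [displacement_apply, ← sub_add_cancel (σ y - y) (algebraMap R A (ε (σ y)))]
  refine Ideal.add_mem _ (Ideal.mem_sup_left this) (Ideal.mem_sup_right ?_)
  rw [hr, map_mul, map_pow]
  exact Ideal.mul_mem_right _ _ (Ideal.mem_span_singleton_self _)

lemma map_sq_mem (h : IsCloseToId ε π σ d l) {s : A} (hs : s ∈ RingHom.ker ε ^ 2) :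
    σ s ∈ RingHom.ker ε ^ 2 ⊔ Ideal.span {algebraMap R A π ^ d} := by
  have h1 : RingHom.ker ε ≤ (RingHom.ker ε ⊔ Ideal.span {algebraMap R A π ^ d}).comap σ := by
    intro y hy
    obtain ⟨r, hr⟩ := h.dvd_eval y hy
    rw [Ideal.mem_comap, ← sub_add_cancel (σ y) (algebraMap R A (ε (σ y)))]
    refine Ideal.add_mem _ (Ideal.mem_sup_left (eval_sub_algebraMap_eval ε _))
      (Ideal.mem_sup_right ?_)
    rw [hr, map_mul, map_pow]
    exact Ideal.mul_mem_right _ _ (Ideal.mem_span_singleton_self _)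
  exact sup_sq_le _ _ (Ideal.le_comap_pow σ 2 (Ideal.pow_right_mono h1 2 hs))

lemma dvd_eval_sq (h : IsCloseToId ε π σ d l) {s : A} (hs : s ∈ RingHom.ker ε ^ 2) :
    π ^ (d + d) ∣ ε (σ s) := by
  have h1 : RingHom.ker ε ≤ (Ideal.span {π ^ d}).comap (ε.comp σ) := fun y hy =>
    Ideal.mem_span_singleton.mpr (h.dvd_eval y hy)
  have h2 := Ideal.le_comap_pow (ε.comp σ) 2 (Ideal.pow_right_mono h1 2 hs)
  rw [Ideal.mem_comap, Ideal.span_singleton_pow, Ideal.mem_span_singleton, ← pow_mul, mul_two]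
    at h2
  exact h2

/-- Each application of the displacement operator gains a factor `π ^ l` on the linear part. -/
lemma displacement_mem_filtration (h : IsCloseToId ε π σ d l) {c : ℕ} {z : A}
    (hz : z ∈ idealFiltration ε π d c) : displacement σ z ∈ idealFiltration ε π d (c + l) := by
  obtain ⟨y, s, w, hy, hs, rfl⟩ := mem_idealFiltration.mp hz
  have hsw : ∀ t, t ∈ RingHom.ker ε ^ 2 ⊔ Ideal.span {algebraMap R A π ^ d} →
      t ∈ idealFiltration ε π d (c + l) := fun t ht =>
    (sup_le (le_sup_right.trans le_sup_left) le_sup_right :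
      _ ≤ idealFiltration ε π d (c + l)) ht
  rw [map_add, map_add]
  refine Ideal.add_mem _ (Ideal.add_mem _ ?_ (hsw _ ?_)) (hsw _ ?_)
  · obtain ⟨y', s', w', hy', hs', hw'⟩ := mem_idealFiltration.mp (h.displacement_mem y)
    rw [← Algebra.smul_def, map_smul, hw', Algebra.smul_def]
    refine mem_idealFiltration.mpr ⟨y', algebraMap R A (π ^ c) * s', algebraMap R A (π ^ c) * w',
      hy', Ideal.mul_mem_left _ _ hs', ?_⟩
    rw [pow_add, map_mul]; ring
  · rw [displacement_apply]
    exact Ideal.sub_mem _ (h.map_sq_mem hs) (Ideal.mem_sup_left hs)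
  · rw [← Algebra.smul_def, map_smul, Algebra.smul_def, map_pow]
    exact Ideal.mem_sup_right (Ideal.mul_mem_right _ _ (Ideal.mem_span_singleton_self _))

/-- On the values at `ε`, a linear part divisible by `π ^ c` gains `π ^ c` over the displacement
`π ^ d` of the point, and a quadratic part gains a second factor `π ^ d`. -/
lemma dvd_eval_displacement_filtration (h : IsCloseToId ε π σ d l) {c : ℕ} {z : A}
    (hz : z ∈ idealFiltration ε π d c) : π ^ (d + min c d) ∣ ε (displacement σ z) := by
  obtain ⟨y, s, w, hy, hs, rfl⟩ := mem_idealFiltration.mp hz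
  rw [map_add, map_add, map_add, map_add, ← Algebra.smul_def, ← Algebra.smul_def, map_smul,
    map_smul, map_smul, map_smul, smul_eq_mul, smul_eq_mul]
  refine dvd_add (dvd_add ?_ ?_) ?_
  · refine (pow_dvd_pow π (show d + min c d ≤ c + d by omega)).trans ?_
    rw [pow_add]
    exact mul_dvd_mul_left _ (h.dvd_eval_displacement y)
  · have hs0 : ε s = 0 := Ideal.pow_le_self two_ne_zero hs
    rw [displacement_apply, map_sub, hs0, sub_zero]
    exact (pow_dvd_pow π (show d + min c d ≤ d + d by omega)).trans (h.dvd_eval_sq hs)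
  · refine (pow_dvd_pow π (show d + min c d ≤ d + d by omega)).trans ?_
    rw [pow_add]
    exact mul_dvd_mul_left _ (h.dvd_eval_displacement w)

lemma displacement_pow_mem (h : IsCloseToId ε π σ d l) {y : A} (hy : ε y = 0) (i : ℕ) :
    (displacement σ ^ i) y ∈ idealFiltration ε π d (i * l) := by
  induction i with
  | zero => exact mem_idealFiltration.mpr ⟨y, 0, 0, hy, Ideal.zero_mem _, by simp⟩
  | succ i ih =>
    rw [pow_succ', Module.End.mul_apply, Nat.succ_mul]
    exact h.displacement_mem_filtration ih

/-- The effect on the two exponents of passing from `σ` to `σ ^ q`. The expansion of `σ ^ q - 1`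
has middle terms divisible by `q`, hence by `π ^ v`, and a last term `δ ^ q`, which carries `π ^ (q l)`
on the linear part and `π ^ (d + min ((q - 1) l) d)` on the constant term. -/
theorem pow_prime (h : IsCloseToId ε π σ d l) {q v : ℕ} (hq : q.Prime) (hv : π ^ v ∣ (q : R)) :
    IsCloseToId ε π (σ ^ q) (d + min v (min ((q - 1) * l) d)) (min (v + l) (min (q * l) d)) where
  dvd_eval y hy := by
    obtain ⟨w, hw⟩ := exists_pow_prime_apply σ hq y
    rw [hw, map_add, map_add, hy, zero_add, map_mul, map_natCast]
    refine dvd_add ?_ ?_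
    · refine (pow_dvd_pow π (show _ ≤ v + d by omega)).trans ?_
      rw [pow_add]
      exact mul_dvd_mul hv (h.dvd_eval_displacement _)
    · obtain ⟨k, rfl⟩ := Nat.exists_eq_succ_of_ne_zero hq.ne_zero
      rw [pow_succ', Module.End.mul_apply]
      refine (pow_dvd_pow π ?_).trans
        (h.dvd_eval_displacement_filtration (h.displacement_pow_mem hy k))
      simp only [Nat.succ_eq_add_one, Nat.add_sub_cancel]
      omega
  linear_part y hy := by
    obtain ⟨w, hw⟩ := exists_pow_prime_apply σ hq y
    set m := min (v + l) (min (q * l) d) with hm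
    have hz : (σ ^ q) y - y ∈ idealFiltration ε π d m := by
      rw [hw, add_assoc, add_sub_cancel_left]
      refine Ideal.add_mem _ ?_ (idealFiltration_mono (by omega) (h.displacement_pow_mem hy q))
      obtain ⟨y', s', w', hy', hs', hw'⟩ :=
        mem_idealFiltration.mp (h.displacement_mem (y + displacement σ w))
      obtain ⟨r, hr⟩ := hv
      refine idealFiltration_mono (c := v + l) (by omega) (mem_idealFiltration.mpr
        ⟨algebraMap R A r * y', q * s', q * w', by simp [hy'], Ideal.mul_mem_left _ _ hs', ?_⟩)
      have hr' : (q : A) = algebraMap R A (π ^ v) * algebraMap R A r := by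
        rw [← map_mul, ← hr, map_natCast]
      rw [hw', pow_add, map_mul, hr']; ring
    obtain ⟨y', s', w', hy', hs', hw'⟩ := mem_idealFiltration.mp hz
    have hs0 : ε s' = 0 := Ideal.pow_le_self two_ne_zero hs'
    have he : ε ((σ ^ q) y) = π ^ d * ε w' := by
      have := congr(ε $hw')
      rw [map_sub, hy, sub_zero] at this
      rw [this, map_add, map_add, map_mul, map_mul, hy', hs0]; simp
    -- the constant term of `σ ^ q y - y` is already known to be `ε (σ ^ q y)`; the rest of the
    -- multiple of `π ^ d` lies in `π ^ d • I`
    obtain ⟨k, hk⟩ : ∃ k, d = m + k := ⟨d - m, by omega⟩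
    refine Submodule.mem_sup.mpr ⟨_, Ideal.mem_span_singleton_mul.mpr
      ⟨y' + algebraMap R A (π ^ k) * (w' - algebraMap R A (ε w')), ?_, rfl⟩, s', hs', ?_⟩
    · simp [RingHom.mem_ker, hy']
    · rw [hw', he, hk, pow_add]
      simp only [map_mul, map_pow]
      ring

/-- If the point `ε` has exact period `q` under `σ`, the term `q δ` in the expansion of
`σ ^ q - 1` has to be cancelled at `ε` by the term `δ ^ q`, whose values at `ε` are divisible by
`π ^ (D + min ((q - 1) l) D)` for the exact exponent `D` of the displacement of `ε`. -/
theorem le_of_pow_prime [IsDomain R] [IsDiscreteValuationRing R] (h : IsCloseToId ε π σ d l)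
    (hπ : Irreducible π) (hd : 1 ≤ d) (hl : 1 ≤ l) {q v : ℕ} (hq : q.Prime)
    (hv : ¬ π ^ (v + 1) ∣ (q : R)) (hσ : ε.comp σ ≠ ε) (hσq : ε.comp (σ ^ q) = ε) :
    min ((q - 1) * l) d ≤ v := by
  obtain ⟨y₀, hy₀, hne⟩ : ∃ y, ε y = 0 ∧ ε (σ y) ≠ 0 := by
    by_contra! hcon
    refine hσ (AlgHom.ext fun a => ?_)
    have := hcon _ (eval_sub_algebraMap_eval ε a)
    simpa [sub_eq_zero] using this
  obtain ⟨N, hN⟩ : ∃ N, ¬ π ^ N ∣ ε (σ y₀) := by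
    obtain ⟨N, hN⟩ := IsDiscreteValuationRing.eq_unit_mul_pow_irreducible hne hπ
    obtain ⟨u, hu⟩ := hN
    refine ⟨N + 1, fun hdvd => hπ.not_isUnit ?_⟩
    rw [hu, Units.dvd_mul_left, pow_dvd_pow_iff hπ.ne_zero hπ.not_isUnit] at hdvd
    omega
  -- the largest exponent `D` for which `ε ∘ σ ≡ ε` modulo `π ^ D`
  classical
  have hex : ∃ N, ∃ y, ε y = 0 ∧ ¬ π ^ N ∣ ε (σ y) := ⟨N, y₀, hy₀, hN⟩
  obtain ⟨y, hy, hyN⟩ := Nat.find_spec hex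
  have hdlt : d < Nat.find hex := by
    by_contra! hle
    exact hyN ((pow_dvd_pow π hle).trans (h.dvd_eval y hy))
  obtain ⟨D, hD⟩ : ∃ D, Nat.find hex = D + 1 := ⟨Nat.find hex - 1, by omega⟩
  have hDmin : ∀ y, ε y = 0 → π ^ D ∣ ε (σ y) := by
    intro y hy
    by_contra hcon
    exact Nat.find_min hex (m := D) (by omega) ⟨y, hy, hcon⟩
  rw [hD] at hyN hdlt
  have h' : IsCloseToId ε π σ D l := ⟨hDmin, h.linear_part⟩
  obtain ⟨w, hw⟩ := exists_pow_prime_apply σ hq y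
  obtain ⟨u, hu⟩ := h'.dvd_eval_displacement (y + displacement σ w)
  -- `δ y` and `δ (y + δ w)` agree at `ε` modulo `π ^ (D + 1)`, so `D` is the exact exponent of both
  have hπu : ¬ π ∣ u := by
    rintro ⟨t, rfl⟩
    have h2 := h'.dvd_eval_displacement_filtration (h'.displacement_mem w)
    replace h2 := (pow_dvd_pow π (show D + 1 ≤ D + min l D by omega)).trans h2
    have h1 : ε (σ y) =
        ε (displacement σ (y + displacement σ w)) - ε (displacement σ (displacement σ w)) := by
      rw [map_add, map_add, add_sub_cancel_right, displacement_apply, map_sub, hy, sub_zero]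
    rw [h1, hu] at hyN
    exact hyN (dvd_sub ⟨t, by ring⟩ h2)
  by_contra! hcon
  have hq1 : π ^ (D + (v + 1)) ∣ ε ((displacement σ ^ q) y) := by
    obtain ⟨k, rfl⟩ := Nat.exists_eq_succ_of_ne_zero hq.ne_zero
    rw [pow_succ', Module.End.mul_apply]
    refine (pow_dvd_pow π ?_).trans
      (h'.dvd_eval_displacement_filtration (h'.displacement_pow_mem hy k))
    simp only [Nat.succ_eq_add_one, Nat.add_sub_cancel] at hcon
    omega
  have hzero : ε ((σ ^ q) y) = 0 := (DFunLike.congr_fun hσq y).trans hy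
  rw [hw, map_add, map_add, hy, zero_add, map_mul, map_natCast, hu] at hzero
  rw [eq_neg_of_add_eq_zero_right hzero, dvd_neg, pow_add,
    show (q : R) * (π ^ D * u) = π ^ D * (q * u) by ring,
    mul_dvd_mul_iff_left (pow_ne_zero _ hπ.ne_zero)] at hq1
  exact hv (hπ.prime.pow_dvd_of_dvd_mul_right _ hπu hq1)

/-- For odd `p` a common lower bound for `d` and `2 l` doubles at each passage to the `p`-th power,
until it exceeds `v`: the new `d` is at least `d + min (2 l) d` and the new `l` at least
`min (3 l) d`, up to terms involving `v`. -/
lemma exists_pow_prime_pow_of_odd (h : IsCloseToId ε π σ 1 1) {p v : ℕ} (hp : p.Prime)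
    (hp2 : p ≠ 2) (hv1 : 1 ≤ v) (hv : π ^ v ∣ (p : R)) (e : ℕ) :
    ∃ d l, IsCloseToId ε π (σ ^ p ^ e) d l ∧ 1 ≤ l ∧ min (2 ^ e) (v + 1) ≤ d ∧
      min (2 ^ e) (v + 1) ≤ 2 * l := by
  have hp3 : 3 ≤ p := by have := hp.two_le; omega
  induction e with
  | zero => exact ⟨1, 1, by simpa using h, le_rfl, by simp, by simp⟩
  | succ e ih =>
    obtain ⟨d, l, h, hl, hde, hle⟩ := ih
    have h1 : 2 * l ≤ (p - 1) * l := Nat.mul_le_mul_right l (by omega)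
    have h2 : 3 * l ≤ p * l := Nat.mul_le_mul_right l hp3
    have h3 : 1 ≤ 2 ^ e := Nat.one_le_two_pow
    have h4 := h.pow_prime hp hv
    rw [← pow_mul, ← pow_succ] at h4
    have h5 : 2 ^ (e + 1) = 2 ^ e * 2 := pow_succ 2 e
    refine ⟨_, _, h4, ?_, ?_, ?_⟩ <;> omega

/-- For `p = 2` the new exponents are `d + min l d` and `min (2 l) d`, up to terms involving `v`, so
that `(l, d)` grows like a pair of consecutive Fibonacci numbers until it exceeds `v`. -/
lemma exists_pow_two_pow (h : IsCloseToId ε π σ 1 1) {v : ℕ}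
    (hv1 : 1 ≤ v) (hv : π ^ v ∣ ((2 : ℕ) : R)) (e : ℕ) :
    ∃ d l, IsCloseToId ε π (σ ^ 2 ^ e) d l ∧ 1 ≤ l ∧ min (Nat.fib (e + 2)) (v + 1) ≤ d ∧
      min (Nat.fib (e + 1)) (v + 1) ≤ l := by
  induction e with
  | zero => exact ⟨1, 1, by simpa using h, le_rfl, by simp, by simp⟩
  | succ e ih =>
    obtain ⟨d, l, h, hl, hde, hle⟩ := ih
    have h1 : Nat.fib (e + 1 + 2) = Nat.fib (e + 1) + Nat.fib (e + 2) := Nat.fib_add_two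
    have h2 : Nat.fib (e + 1) ≤ Nat.fib (e + 2) := Nat.fib_le_fib_succ
    have h3 : Nat.fib (e + 2) = Nat.fib e + Nat.fib (e + 1) := Nat.fib_add_two
    have h5 : Nat.fib e ≤ Nat.fib (e + 1) := Nat.fib_le_fib_succ
    have h6 : 0 < Nat.fib (e + 1) := Nat.fib_pos.mpr (by omega)
    have h4 := h.pow_prime Nat.prime_two hv
    rw [← pow_mul, ← pow_succ] at h4
    rw [show e + 1 + 1 = e + 2 from rfl]
    refine ⟨_, _, h4, ?_, ?_, ?_⟩ <;> omega

section DVR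
variable [IsDomain R] [IsDiscreteValuationRing R] {p v e : ℕ}

theorem two_pow_le (h : IsCloseToId ε π σ 1 1) (hπ : Irreducible π) (hp : p.Prime)
    (hp2 : p ≠ 2) (hv1 : 1 ≤ v) (hv : π ^ v ∣ (p : R)) (hv' : ¬ π ^ (v + 1) ∣ (p : R))
    (hne : ε.comp (σ ^ p ^ e) ≠ ε) (heq : ε.comp (σ ^ p ^ (e + 1)) = ε) : 2 ^ e ≤ v := by
  obtain ⟨d, l, h', hl, hde, hle⟩ := h.exists_pow_prime_pow_of_odd hp hp2 hv1 hv e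
  rw [pow_succ, pow_mul] at heq
  have h3 : 1 ≤ 2 ^ e := Nat.one_le_two_pow
  have h1 : 2 * l ≤ (p - 1) * l := Nat.mul_le_mul_right l (by have := hp.two_le; omega)
  have := h'.le_of_pow_prime hπ (by omega) hl hp hv' hne heq
  omega

theorem fib_le (h : IsCloseToId ε π σ 1 1) (hπ : Irreducible π)
    (hv1 : 1 ≤ v) (hv : π ^ v ∣ ((2 : ℕ) : R)) (hv' : ¬ π ^ (v + 1) ∣ ((2 : ℕ) : R))
    (hne : ε.comp (σ ^ 2 ^ e) ≠ ε) (heq : ε.comp (σ ^ 2 ^ (e + 1)) = ε) :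
    Nat.fib (e + 1) ≤ v := by
  obtain ⟨d, l, h', hl, hde, hle⟩ := h.exists_pow_two_pow hv1 hv e
  rw [pow_succ 2 e, pow_mul] at heq
  have h2 : Nat.fib (e + 1) ≤ Nat.fib (e + 2) := Nat.fib_le_fib_succ
  have h6 : 0 < Nat.fib (e + 1) := Nat.fib_pos.mpr (by omega)
  have := h'.le_of_pow_prime hπ (by omega) hl Nat.prime_two hv' hne heq
  omega
end DVR

end IsCloseToId
end Core

/-! ### From integral bounds to logarithms -/

lemma le_one_add_logb_two {e v : ℕ} (hv : 1 ≤ v) (h : ∀ k, e = k + 1 → 2 ^ k ≤ v) :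
    (e : ℝ) ≤ 1 + Real.logb 2 v := by
  have hv' : (1 : ℝ) ≤ v := by exact_mod_cast hv
  rcases e with _ | k
  · have := Real.logb_nonneg one_lt_two hv'
    rw [Nat.cast_zero]; linarith
  · have h1 : (k : ℝ) ≤ Real.logb 2 v := by
      rw [Real.le_logb_iff_rpow_le one_lt_two (by linarith), Real.rpow_natCast]
      exact_mod_cast h k rfl
    push_cast; linarith

lemma goldenRatio_pow_le_sqrt_five_mul_fib (k : ℕ) :
    Real.goldenRatio ^ k ≤ Real.sqrt 5 * Nat.fib (k + 1) := by
  have h5 : (2 : ℝ) ≤ Real.sqrt 5 := Real.le_sqrt_of_sq_le (by norm_num)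
  have h1 := Real.goldenRatio_mul_fib_succ_add_fib k
  have h2 : (Nat.fib k : ℝ) ≤ Nat.fib (k + 1) := by exact_mod_cast Nat.fib_le_fib_succ
  have h3 : Real.goldenRatio * Real.goldenRatio ^ k ≤
      Real.goldenRatio * (Real.goldenRatio * Nat.fib (k + 1)) := by
    rw [← pow_succ', ← h1, ← mul_assoc, ← sq, Real.goldenRatio_sq]
    linarith
  refine (le_of_mul_le_mul_left h3 Real.goldenRatio_pos).trans ?_
  gcongr
  rw [Real.goldenRatio]; linarith

lemma le_one_add_logb_goldenRatio {e v : ℕ} (hv : 1 ≤ v)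
    (h : ∀ k, e = k + 1 → Nat.fib (k + 1) ≤ v) :
    (e : ℝ) ≤ 1 + Real.logb ((1 + Real.sqrt 5) / 2)
      ((Real.sqrt 5 * v + Real.sqrt (5 * (v : ℝ) ^ 2 + 4)) / 2) := by
  have hv' : (1 : ℝ) ≤ v := by exact_mod_cast hv
  have h5 : (2 : ℝ) ≤ Real.sqrt 5 := Real.le_sqrt_of_sq_le (by norm_num)
  have hr : (2 : ℝ) ≤ Real.sqrt (5 * (v : ℝ) ^ 2 + 4) := Real.le_sqrt_of_sq_le (by nlinarith)
  have hs : Real.sqrt 5 * v ≤ Real.sqrt (5 * (v : ℝ) ^ 2 + 4) :=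
    Real.le_sqrt_of_sq_le (by rw [mul_pow, Real.sq_sqrt (by norm_num)]; linarith)
  have h5v : Real.sqrt 5 * 1 ≤ Real.sqrt 5 * v := by gcongr
  change _ ≤ 1 + Real.logb Real.goldenRatio _
  rcases e with _ | k
  · have := Real.logb_nonneg Real.one_lt_goldenRatio
      (show 1 ≤ (Real.sqrt 5 * v + Real.sqrt (5 * (v : ℝ) ^ 2 + 4)) / 2 by linarith)
    rw [Nat.cast_zero]; linarith
  · have h1 : (k : ℝ) ≤ Real.logb Real.goldenRatio
        ((Real.sqrt 5 * v + Real.sqrt (5 * (v : ℝ) ^ 2 + 4)) / 2) := by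
      rw [Real.le_logb_iff_rpow_le Real.one_lt_goldenRatio (by linarith), Real.rpow_natCast]
      refine le_trans ?_ (show Real.sqrt 5 * v ≤ _ by linarith)
      have : (Nat.fib (k + 1) : ℝ) ≤ v := by exact_mod_cast h k rfl
      exact (goldenRatio_pow_le_sqrt_five_mul_fib k).trans (by gcongr)
    push_cast; linarith

/-! ### Cotangent spaces of local rings -/

section LocalRing
open IsLocalRing

lemma mapCotangent_pow_toCotangent {S B : Type*} [CommRing S] [CommRing B] [Algebra S B]
    (I : Ideal B) (τ : B →ₐ[S] B) (h : I ≤ I.comap τ) (k : ℕ) (x : I) :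
    ∃ y : I, (y : B) = τ^[k] x ∧
      ((Ideal.mapCotangent I I τ h : Module.End S I.Cotangent) ^ k) (I.toCotangent x) =
        I.toCotangent y := by
  induction k with
  | zero => exact ⟨x, rfl, rfl⟩
  | succ k ih =>
    obtain ⟨y, hy, hxy⟩ := ih
    refine ⟨⟨τ y, h y.2⟩, ?_, ?_⟩
    · rw [Function.iterate_succ_apply', ← hy]
    · rw [pow_succ', Module.End.mul_apply, hxy, Ideal.mapCotangent_toCotangent]

lemma mapCotangent_pow_eq_one_iff {S B : Type*} [CommRing S] [CommRing B] [Algebra S B]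
    (I : Ideal B) (τ : B →ₐ[S] B) (h : I ≤ I.comap τ) (k : ℕ) :
    (Ideal.mapCotangent I I τ h : Module.End S I.Cotangent) ^ k = 1 ↔
      ∀ x ∈ I, τ^[k] x - x ∈ I ^ 2 := by
  constructor
  · intro hk x hx
    obtain ⟨y, hy, hxy⟩ := mapCotangent_pow_toCotangent I τ h k ⟨x, hx⟩
    rw [hk, Module.End.one_apply, eq_comm, Ideal.toCotangent_eq] at hxy
    rwa [← hy]
  · intro hk
    refine LinearMap.ext fun z => ?_
    obtain ⟨x, rfl⟩ := I.toCotangent_surjective z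
    obtain ⟨y, hy, hxy⟩ := mapCotangent_pow_toCotangent I τ h k x
    rw [hxy, Module.End.one_apply, Ideal.toCotangent_eq, hy]
    exact hk x x.2

lemma mem_sq_sup_of_map_mem_sq {A B : Type*} [CommRing A] [CommRing B]
    [IsLocalRing A] [IsLocalRing B] (q : A →+* B) [IsLocalHom q] (hq : Function.Surjective q)
    {J : Ideal A} (hJ : RingHom.ker q ≤ J) {a : A} (ha : q a ∈ maximalIdeal B ^ 2) :
    a ∈ maximalIdeal A ^ 2 ⊔ J := by
  have h1 : (maximalIdeal A).map q = maximalIdeal B := by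
    refine le_antisymm (map_maximalIdeal_le q) fun b hb => ?_
    obtain ⟨a, rfl⟩ := hq b
    exact Ideal.mem_map_of_mem _ (by
      rw [← IsLocalRing.maximalIdeal_comap q]; exact hb)
  rw [← h1, ← Ideal.map_pow, Ideal.mem_map_iff_of_surjective q hq] at ha
  obtain ⟨b, hb, hba⟩ := ha
  rw [← add_sub_cancel b a]
  exact Ideal.add_mem _ (Ideal.mem_sup_left hb)
    (Ideal.mem_sup_right (hJ (by rw [RingHom.mem_ker, map_sub, hba, sub_self])))

/-- A congruence of `σ` to the identity on the cotangent space of `A / π A` at the closed point gives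
closeness to the identity with both exponents equal to `1`, because the maximal ideal of `A` is
`ker ε + π A`. -/
lemma isCloseToId_one_one {R A : Type*} [CommRing R] [IsLocalRing R] [CommRing A] [IsLocalRing A]
    [Algebra R A] (ε : A →ₐ[R] R) (hε : IsLocalHom ε) {π : R} (hπ : maximalIdeal R = Ideal.span {π})
    (σ : A →ₐ[R] A)
    (h : ∀ a ∈ maximalIdeal A, σ a - a ∈ maximalIdeal A ^ 2 ⊔ Ideal.span {algebraMap R A π}) :
    IsCloseToId ε π σ 1 1 := by
  have hdvd : ∀ a, a ∈ maximalIdeal A → π ∣ ε a := by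
    intro a ha
    rw [← Ideal.mem_span_singleton, ← hπ]
    exact fun hu => ha (hε.map_nonunit a hu)
  have hker : ∀ a, ε a = 0 → a ∈ maximalIdeal A := by
    intro a ha hu
    exact not_isUnit_zero (ha ▸ hu.map ε)
  have hπA : algebraMap R A π ∈ maximalIdeal A := by
    intro hu
    have h1 := hu.map ε
    rw [AlgHom.commutes] at h1
    have h2 : π ∈ maximalIdeal R := hπ ▸ Ideal.mem_span_singleton_self π
    exact h2 h1
  have hmax : maximalIdeal A ≤ RingHom.ker ε ⊔ Ideal.span {algebraMap R A π} := by
    intro a ha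
    obtain ⟨r, hr⟩ := hdvd a ha
    rw [← sub_add_cancel a (algebraMap R A (ε a))]
    refine Ideal.add_mem _ (Ideal.mem_sup_left (eval_sub_algebraMap_eval ε a))
      (Ideal.mem_sup_right ?_)
    rw [hr, map_mul]
    exact Ideal.mul_mem_right _ _ (Ideal.mem_span_singleton_self _)
  have hfil : maximalIdeal A ^ 2 ⊔ Ideal.span {algebraMap R A π} ≤ idealFiltration ε π 1 1 := by
    have h3 : Ideal.span {algebraMap R A π} ≤ idealFiltration ε π 1 1 := by
      rw [idealFiltration, pow_one]; exact le_sup_right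
    refine sup_le ((Ideal.pow_right_mono hmax 2).trans ((sup_sq_le _ _).trans ?_)) h3
    exact sup_le (le_sup_of_le_left le_sup_right) h3
  have hle : maximalIdeal A ^ 2 ⊔ Ideal.span {algebraMap R A π} ≤ maximalIdeal A :=
    sup_le (Ideal.pow_le_self two_ne_zero)
      ((Ideal.span_singleton_le_iff_mem _).mpr hπA)
  refine ⟨fun y hy => ?_, fun y hy => ?_⟩
  · have h1 := hdvd _ (hle (h y (hker y hy)))
    rwa [map_sub, hy, sub_zero, ← pow_one π] at h1
  · obtain ⟨y', s, w, hy', hs, hw⟩ := mem_idealFiltration.mp (hfil (h y (hker y hy)))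
    have hs0 : ε s = 0 := Ideal.pow_le_self two_ne_zero hs
    have he : ε (σ y) = π * ε w := by
      have := congr(ε $hw)
      rw [map_sub, hy, sub_zero] at this
      rw [this, map_add, map_add, map_mul, map_mul, hy', hs0]; simp
    refine Submodule.mem_sup.mpr ⟨_, Ideal.mem_span_singleton_mul.mpr
      ⟨y' + (w - algebraMap R A (ε w)), ?_, rfl⟩, s, hs, ?_⟩
    · simp [RingHom.mem_ker, hy']
    · rw [hw, he]
      simp only [map_mul, pow_one]
      ring
end LocalRing

/-! ### Stalk maps at a given image point -/

section Stalk
variable {X Y : Scheme.{u}}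

/-- The map of stalks induced by `f` at `x`, with the image point `f x` replaced by a point `y`
equal to it; for an endomorphism fixing `x = y` this is `stalkEndo`. -/
def stalkHom (f : X ⟶ Y) (x : X) (y : Y) (h : f x = y) :
    Y.presheaf.stalk y ⟶ X.presheaf.stalk x :=
  (Y.presheaf.stalkCongr (.of_eq h)).inv ≫ f.stalkMap x

lemma map_stalkHom_fromSpecStalk (f : X ⟶ Y) (x : X) (y : Y) (h : f x = y) :
    Spec.map (stalkHom f x y h) ≫ Y.fromSpecStalk y = X.fromSpecStalk x ≫ f := by
  subst h
  simp [stalkHom]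

lemma stalkHom_surjective (f : X ⟶ Y) [SurjectiveOnStalks f] (x : X) (y : Y) (h : f x = y) :
    Function.Surjective (stalkHom f x y h) := by
  subst h
  simpa [stalkHom] using f.stalkMap_surjective x

instance (f : X ⟶ Y) (x : X) (y : Y) (h : f x = y) : IsLocalHom (stalkHom f x y h).hom := by
  rw [stalkHom]
  infer_instance

/-- Since `fromSpecStalk` is a monomorphism, identities between maps out of a stalk can be checked as
identities between morphisms of schemes. -/
lemma stalkHom_ext {B : CommRingCat.{u}} {y : Y} {a b : Y.presheaf.stalk y ⟶ B}
    (h : Spec.map a ≫ Y.fromSpecStalk y = Spec.map b ≫ Y.fromSpecStalk y) : a = b :=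
  Spec.map_injective ((cancel_mono _).mp h)

end Stalk

/-! ### Iterates and the union of the orbit -/

lemma iterateHom_succ {X : Scheme.{u}} (φ : X ⟶ X) (i : ℕ) :
    iterateHom φ (i + 1) = iterateHom φ i ≫ φ := iteratePoint_succ _ _ _

lemma iterateHom_add {X : Scheme.{u}} (φ : X ⟶ X) (i j : ℕ) :
    iterateHom φ (i + j) = iterateHom φ i ≫ iterateHom φ j := by
  induction j with
  | zero => exact (Category.comp_id _).symm
  | succ j ih => rw [← add_assoc, iterateHom_succ, ih, iterateHom_succ, Category.assoc]

lemma iterateHom_mul {X : Scheme.{u}} (φ : X ⟶ X) (i j : ℕ) :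
    iterateHom φ (i * j) = iterateHom (iterateHom φ i) j := by
  induction j with
  | zero => rfl
  | succ j ih => rw [Nat.mul_succ, iterateHom_add, ih, iterateHom_succ]

lemma iterateHom_comp {X Y : Scheme.{u}} (φ : X ⟶ X) (ψ : Y ⟶ Y) (g : X ⟶ Y)
    (h : φ ≫ g = g ≫ ψ) (i : ℕ) : iterateHom φ i ≫ g = g ≫ iterateHom ψ i := by
  induction i with
  | zero => exact (Category.id_comp _).trans (Category.comp_id _).symm
  | succ i ih =>
    rw [iterateHom_succ, iterateHom_succ, Category.assoc, h, ← Category.assoc, ih,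
      Category.assoc]

/-- The `k`-th power of an endomorphism of a commutative ring. -/
def endPow {A : CommRingCat.{u}} (a : A ⟶ A) (k : ℕ) : A ⟶ A :=
  CommRingCat.ofHom (a.hom ^ k)

lemma endPow_apply {A : CommRingCat.{u}} (a : A ⟶ A) (k : ℕ) (x : A) :
    (endPow a k).hom x = a.hom^[k] x :=
  congr_fun (RingHom.coe_pow a.hom k) x

lemma map_endPow_comp {Y : Scheme.{u}} (ψ : Y ⟶ Y) {A : CommRingCat.{u}} (a : A ⟶ A)
    (t : Spec A ⟶ Y) (h : Spec.map a ≫ t = t ≫ ψ) (k : ℕ) :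
    Spec.map (endPow a k) ≫ t = t ≫ iterateHom ψ k := by
  induction k with
  | zero =>
    change Spec.map (𝟙 _) ≫ _ = _ ≫ 𝟙 _
    simp
  | succ k ih =>
    have : endPow a (k + 1) = a ≫ endPow a k := by
      rw [endPow, pow_succ]; rfl
    rw [this, Spec.map_comp, Category.assoc, h, reassoc_of% ih, iterateHom_succ]

/-- An endomorphism over `Spec R` that fixes all sections in the orbit of `P` restricts to the
identity on their scheme-theoretic union: the equalizer with the identity is a closed subscheme, as
`f` is separated, and contains every section, hence contains the union. -/
lemma orbitInclusion_comp_eq_of_forall {R : Type u} [CommRing R] {X : Scheme.{u}}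
    (f : X ⟶ Spec (.of R)) [IsSeparated f] (φ : X ⟶ X) (P : Spec (.of R) ⟶ X) (hP : P ≫ f = 𝟙 _)
    (hφ : φ ≫ f = f) (ψ : X ⟶ X) (hψ : ψ ≫ f = f)
    (h : ∀ i, iteratePoint φ P i ≫ ψ = iteratePoint φ P i) :
    orbitInclusion φ P ≫ ψ = orbitInclusion φ P := by
  let a : Over.mk f ⟶ Over.mk f := Over.homMk ψ hψ
  have : IsSeparated (Over.mk f).hom := by assumption
  let κ := (equalizer.ι a (𝟙 (Over.mk f))).left
  have hκ : κ ≫ ψ = κ := by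
    have := congr(($(equalizer.condition a (𝟙 (Over.mk f)))).left)
    simpa [κ, a] using this
  have hP' : ∀ i, iteratePoint φ P i ≫ f = 𝟙 _ := by
    intro i
    induction i with
    | zero => exact hP
    | succ i ih => rw [iteratePoint_succ, Category.assoc, hφ, ih]
  have hker : κ.ker ≤ (orbitInclusion φ P).ker := by
    rw [Scheme.IdealSheafData.ker_subschemeι]
    refine le_iInf fun i => ?_
    let b : Over.mk (𝟙 (Spec (.of R))) ⟶ Over.mk f := Over.homMk (iteratePoint φ P i) (hP' i)
    have hb : b ≫ a = b ≫ 𝟙 _ := by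
      ext1
      simpa [a, b] using h i
    have hl : (equalizer.lift b hb).left ≫ κ = iteratePoint φ P i :=
      congr(($(equalizer.lift_ι b hb)).left)
    rw [← hl]
    exact Scheme.Hom.le_ker_comp _ _
  rw [← IsClosedImmersion.lift_fac κ (orbitInclusion φ P) hker, Category.assoc, hκ]

/-! ### The local ring of the special fibre -/

instance {R : Type u} [CommRing R] [IsLocalRing R] {Y : Scheme.{u}} (g : Y ⟶ Spec (.of R)) :
    IsClosedImmersion (specialFibreFst g) := by
  have : IsClosedImmersion (specResidue R) :=
    IsClosedImmersion.spec_of_surjective _ IsLocalRing.residue_surjective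
  exact MorphismProperty.of_isPullback (isPullback_specialFibre g).flip this

/-- The kernel of `𝒪_{Y,y} ⟶ 𝒪_{Y_k,z}` is contained in (in fact equal to) the ideal generated by
the maximal ideal of `R`. The spectrum of the local ring `A₀ = 𝒪_{Y,y} ⧸ 𝔪_R 𝒪_{Y,y}` maps to the
fibre product `Y_k`, its closed point going to `z`, so the quotient map `𝒪_{Y,y} ⟶ A₀` factors
through `𝒪_{Y_k,z}`. -/
lemma ker_stalkHom_specialFibreFst_le {R : Type u} [CommRing R] [IsLocalRing R] {Y : Scheme.{u}}
    (g : Y ⟶ Spec (.of R)) (z : specialFibre g) (y : Y) (h : specialFibreFst g z = y)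
    (α : CommRingCat.of R ⟶ Y.presheaf.stalk y) (hα : Spec.map α = Y.fromSpecStalk y ≫ g)
    [IsLocalHom α.hom] :
    RingHom.ker (stalkHom (specialFibreFst g) z y h).hom ≤
      (IsLocalRing.maximalIdeal R).map α.hom := by
  set J := (IsLocalRing.maximalIdeal R).map α.hom with hJ
  have hJtop : J ≠ ⊤ := (IsLocalRing.map_maximalIdeal_lt_top α.hom).ne
  have : Nontrivial (Y.presheaf.stalk y ⧸ J) := Ideal.Quotient.nontrivial_iff.mpr hJtop
  have : IsLocalRing (Y.presheaf.stalk y ⧸ J) :=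
    .of_surjective' _ Ideal.Quotient.mk_surjective
  have : IsLocalHom (Ideal.Quotient.mk J) :=
    .of_surjective _ Ideal.Quotient.mk_surjective
  let A₀ : CommRingCat.{u} := .of (Y.presheaf.stalk y ⧸ J)
  let mk : Y.presheaf.stalk y ⟶ A₀ := CommRingCat.ofHom (Ideal.Quotient.mk J)
  let β : IsLocalRing.ResidueField R →+* Y.presheaf.stalk y ⧸ J :=
    Ideal.Quotient.lift (IsLocalRing.maximalIdeal R) ((Ideal.Quotient.mk J).comp α.hom)
      fun a ha => Ideal.Quotient.eq_zero_iff_mem.mpr (Ideal.mem_map_of_mem _ ha)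
  have hβ : CommRingCat.ofHom (IsLocalRing.residue R) ≫ CommRingCat.ofHom β = α ≫ mk := by
    ext a
    rfl
  let t : Spec A₀ ⟶ specialFibre g := (isPullback_specialFibre g).lift
    (Spec.map mk ≫ Y.fromSpecStalk y) (Spec.map (CommRingCat.ofHom β)) (by
      rw [Category.assoc, ← hα, ← Spec.map_comp, ← hβ, Spec.map_comp]
      rfl)
  have ht : t ≫ specialFibreFst g = Spec.map mk ≫ Y.fromSpecStalk y :=
    (isPullback_specialFibre g).lift_fst _ _ _
  have : IsLocalRing A₀ := by assumption
  have htz : t (IsLocalRing.closedPoint A₀) = z := by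
    apply (specialFibreFst g).isClosedEmbedding.injective
    have hmk : IsLocalHom mk.hom := by assumption
    refine congr($ht (IsLocalRing.closedPoint A₀)).trans (Eq.trans ?_ h.symm)
    exact congr(Y.fromSpecStalk y $(Spec_closedPoint (f := mk))).trans
      Scheme.fromSpecStalk_closedPoint
  obtain ⟨b, hb⟩ : ∃ b : (specialFibre g).presheaf.stalk z ⟶ A₀,
      Spec.map b ≫ (specialFibre g).fromSpecStalk z = t := by
    subst htz
    exact ⟨_, Scheme.Spec_stalkClosedPointTo_fromSpecStalk t⟩
  have hcomp : stalkHom (specialFibreFst g) z y h ≫ b = mk := by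
    apply stalkHom_ext
    rw [Spec.map_comp, Category.assoc, map_stalkHom_fromSpecStalk, reassoc_of% hb, ht]
  intro a ha
  rw [← Ideal.Quotient.eq_zero_iff_mem]
  have h1 := congr($hcomp a)
  change _ = Ideal.Quotient.mk J a at h1
  rw [← h1, CommRingCat.comp_apply]
  erw [RingHom.mem_ker.mp ha]
  exact map_zero _

lemma cotangentMap_pow_eq_one_iff {Y : Scheme.{u}} (g : Y ⟶ Y) (x : Y) (hx : g x = x) (k : ℕ) :
    cotangentMap g x hx ^ k = 1 ↔ ∀ a ∈ IsLocalRing.maximalIdeal (Y.presheaf.stalk x),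
      (endPow (stalkHom g x x hx) k).hom a - a ∈
        IsLocalRing.maximalIdeal (Y.presheaf.stalk x) ^ 2 := by
  simp only [endPow_apply]
  exact mapCotangent_pow_eq_one_iff (IsLocalRing.maximalIdeal (Y.presheaf.stalk x))
    (stalkEndo g x hx).hom.toIntAlgHom (stalkEndo_maximalIdeal g x hx) k

/-- Passage from schemes to algebra. For `A` the local ring of `Y` at the closed point of the section
`Q`, `ε` the evaluation at `Q` and `σ` the map induced by `ψ`, the iterates of `Q` are the points
`ε ∘ σ ^ k`; and `σ ^ k` is close to the identity at `ε` as soon as the reduction of `ψ ^ k` is the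
identity on the cotangent space of the special fibre. -/
theorem exists_isCloseToId {R : Type u} [CommRing R] [IsLocalRing R] {Y : Scheme.{u}}
    (g : Y ⟶ Spec (.of R)) (Q : Spec (.of R) ⟶ Y) (hQ : Q ≫ g = 𝟙 _) (ψ : Y ⟶ Y)
    (hψ : ψ ≫ g = g) (ρ : specialFibre g ⟶ specialFibre g)
    (hρ : ρ ≫ specialFibreFst g = specialFibreFst g ≫ ψ) (z : specialFibre g) (hz : ρ z = z)
    (hzQ : specialFibreFst g z = Q (IsLocalRing.closedPoint R)) :
    ∃ (A : Type u) (_ : CommRing A) (_ : Algebra R A) (ε : A →ₐ[R] R) (σ : A →ₐ[R] A),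
      (∀ k, ε.comp (σ ^ k) = ε ↔ Q ≫ iterateHom ψ k = Q) ∧
      ∀ π, IsLocalRing.maximalIdeal R = Ideal.span {π} → ∀ k, cotangentMap ρ z hz ^ k = 1 →
        IsCloseToId ε π (σ ^ k) 1 1 := by
  generalize hx : Q (IsLocalRing.closedPoint R) = x at hzQ
  obtain ⟨ev, hev, hevl⟩ : ∃ ev : Y.presheaf.stalk x ⟶ .of R,
      Spec.map ev ≫ Y.fromSpecStalk x = Q ∧ IsLocalHom ev.hom := by
    subst hx
    exact ⟨_, Scheme.Spec_stalkClosedPointTo_fromSpecStalk Q,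
      Scheme.isLocalHom_stalkClosedPointTo' Q⟩
  have hψx : ψ x = x := by
    rw [← hzQ, ← Scheme.Hom.comp_apply, ← hρ, Scheme.Hom.comp_apply, hz]
  -- the `R`-algebra structure of the local ring at `x`
  let α : CommRingCat.of R ⟶ Y.presheaf.stalk x := Spec.preimage (Y.fromSpecStalk x ≫ g)
  have hα : Spec.map α = Y.fromSpecStalk x ≫ g := Spec.map_preimage _
  have hαev : α ≫ ev = 𝟙 _ := by
    apply Spec.map_injective
    rw [Spec.map_comp, hα, reassoc_of% hev, hQ, Spec.map_id]
  let s := stalkHom ψ x x hψx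
  have hs : Spec.map s ≫ Y.fromSpecStalk x = Y.fromSpecStalk x ≫ ψ :=
    map_stalkHom_fromSpecStalk ψ x x hψx
  have hαs : α ≫ s = α := by
    apply Spec.map_injective
    rw [Spec.map_comp, hα, reassoc_of% hs, hψ]
  have hαl : IsLocalHom α.hom := by
    refine ⟨fun a ha => ?_⟩
    have h1 := ha.map ev.hom
    rwa [show ev.hom (α.hom a) = a from congr($hαev a)] at h1
  let q := stalkHom (specialFibreFst g) z x hzQ
  let τ := stalkHom ρ z z hz
  have hqk : ∀ k, endPow s k ≫ q = q ≫ endPow τ k := by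
    intro k
    apply stalkHom_ext
    rw [Spec.map_comp, Spec.map_comp, Category.assoc, Category.assoc, map_endPow_comp _ _ _ hs,
      ← Category.assoc, map_stalkHom_fromSpecStalk, Category.assoc,
      ← iterateHom_comp _ _ _ hρ, ← Category.assoc, ← Category.assoc,
      map_endPow_comp _ _ _ (map_stalkHom_fromSpecStalk ρ z z hz)]
  let _ : Algebra R (Y.presheaf.stalk x) := α.hom.toAlgebra
  let ε : Y.presheaf.stalk x →ₐ[R] R := ⟨ev.hom, fun r => congr($hαev r)⟩
  let σ : Y.presheaf.stalk x →ₐ[R] Y.presheaf.stalk x := ⟨s.hom, fun r => congr($hαs r)⟩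
  have hσk : ∀ k a, (σ ^ k) a = (endPow s k).hom a := by
    intro k a
    rw [AlgHom.coe_pow, endPow_apply]
    rfl
  refine ⟨Y.presheaf.stalk x, inferInstance, inferInstance, ε, σ, fun k => ?_, ?_⟩
  · have h1 : ε.comp (σ ^ k) = ε ↔ endPow s k ≫ ev = ev := by
      constructor
      · intro h
        ext a
        exact (congr(ev.hom $(hσk k a))).symm.trans (DFunLike.congr_fun h a)
      · intro h
        ext a
        exact (congr(ev.hom $(hσk k a))).trans congr($h a)
    rw [h1, ← hev, Category.assoc, ← map_endPow_comp _ _ _ hs, ← Category.assoc, cancel_mono,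
      ← Spec.map_comp]
    exact ⟨fun h => by rw [h], fun h => Spec.map_injective h⟩
  · intro π hπ k hk
    rw [cotangentMap_pow_eq_one_iff] at hk
    refine isCloseToId_one_one ε ⟨hevl.map_nonunit⟩ hπ _ fun a ha => ?_
    have hql : IsLocalHom q.hom := inferInstanceAs (IsLocalHom (stalkHom _ _ _ _).hom)
    refine mem_sq_sup_of_map_mem_sq q.hom (stalkHom_surjective _ z x hzQ) ?_ ?_
    · refine (ker_stalkHom_specialFibreFst_le g z x hzQ α hα).trans ?_
      rw [hπ, Ideal.map_span, Set.image_singleton]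
      rfl
    · have h1 : q.hom ((endPow s k).hom a) = (endPow τ k).hom (q.hom a) := congr($(hqk k) a)
      rw [map_sub, hσk, h1]
      refine hk _ ?_
      rw [← IsLocalRing.maximalIdeal_comap q.hom] at ha
      exact ha

theorem cotangentMap_pow_eq_one {R : Type u} [CommRing R] [IsLocalRing R] {Y : Scheme.{u}}
    (g : Y ⟶ Spec (.of R)) (ψ : Y ⟶ Y) (ρ : specialFibre g ⟶ specialFibre g)
    (hρ : ρ ≫ specialFibreFst g = specialFibreFst g ≫ ψ) (z : specialFibre g) (hz : ρ z = z)
    (k : ℕ) (hk : iterateHom ψ k = 𝟙 Y) : cotangentMap ρ z hz ^ k = 1 := by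
  have h1 : iterateHom ρ k = 𝟙 _ := by
    rw [← cancel_mono (specialFibreFst g), iterateHom_comp _ _ _ hρ, hk, Category.comp_id,
      Category.id_comp]
  have h2 : endPow (stalkHom ρ z z hz) k = 𝟙 _ := by
    apply stalkHom_ext
    rw [map_endPow_comp _ _ _ (map_stalkHom_fromSpecStalk ρ z z hz), h1]
    rw [Category.comp_id, Spec.map_id, Category.id_comp]
  rw [cotangentMap_pow_eq_one_iff]
  intro a _
  have h3 : (endPow (stalkHom ρ z z hz) k).hom a = a := congr($h2 a)
  rw [h3, sub_self]
  exact Ideal.zero_mem _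

/-! ### The period of a point under a map close to the identity -/

section DVR
variable {R A : Type*} [CommRing R] [IsDomain R] [IsDiscreteValuationRing R] [CommRing A]
  [Algebra R A]

/-- The case `v = 0` of `IsCloseToId.le_of_pow_prime`: a prime that is a unit in `R` cannot divide
the period. -/
lemma period_eq_prime_pow {ε : A →ₐ[R] R} {π : R} {σ : A →ₐ[R] A} (hπ : Irreducible π)
    {p N : ℕ} (hN : N ≠ 0) (hp : ∀ q : ℕ, q.Prime → π ∣ (q : R) → q = p)
    (hclose : ∀ k, IsCloseToId ε π (σ ^ k) 1 1)
    (hper : ∀ k, ε.comp (σ ^ k) = ε ↔ N ∣ k) : ∃ e, N = p ^ e := by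
  refine ⟨_, Nat.eq_prime_pow_of_unique_prime_dvd hN fun {q} hq hqN => hp q hq ?_⟩
  by_contra hcon
  obtain ⟨M, rfl⟩ := hqN
  have hM : 0 < M := Nat.pos_of_ne_zero fun h => hN (by simp [h])
  have h1 : ε.comp (σ ^ M) ≠ ε := by
    rw [Ne, hper]
    intro h
    have := Nat.le_of_dvd hM h
    have := Nat.mul_le_mul_right M hq.two_le
    omega
  have h2 : ε.comp ((σ ^ M) ^ q) = ε := by
    rw [← pow_mul, hper, mul_comm]
  have h3 := (hclose M).le_of_pow_prime hπ le_rfl le_rfl hq (v := 0) (by simpa using hcon) h1 h2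
  have := hq.two_le
  omega

lemma pow_dvd_iff_le_of_addVal_eq {π : R} (hπ : Irreducible π) {a : R} {v : ℕ}
    (h : IsDiscreteValuationRing.addVal R a = v) (i : ℕ) : π ^ i ∣ a ↔ i ≤ v := by
  rw [← IsDiscreteValuationRing.addVal_le_iff_dvd, h, IsDiscreteValuationRing.addVal_pow,
    IsDiscreteValuationRing.addVal_uniformizer hπ]
  simp

theorem exists_period_eq_prime_pow_and_bound {ε : A →ₐ[R] R} {π : R} {σ : A →ₐ[R] A}
    (hπ : Irreducible π) {p N : ℕ} (hp : p.Prime) (hN : N ≠ 0) (hpπ : π ∣ (p : R))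
    (hq : ∀ q : ℕ, q.Prime → π ∣ (q : R) → q = p)
    (hclose : ∀ k, IsCloseToId ε π (σ ^ k) 1 1)
    (hper : ∀ k, ε.comp (σ ^ k) = ε ↔ N ∣ k) :
    ∃ e : ℕ, N = p ^ e ∧ ∀ v : ℕ, IsDiscreteValuationRing.addVal R (p : R) = (v : ℕ∞) →
        (p ≠ 2 → (e : ℝ) ≤ 1 + Real.logb 2 v) ∧
        (p = 2 → (e : ℝ) ≤ 1 + Real.logb ((1 + Real.sqrt 5) / 2)
          ((Real.sqrt 5 * v + Real.sqrt (5 * (v : ℝ) ^ 2 + 4)) / 2)) := by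
  obtain ⟨e, rfl⟩ := period_eq_prime_pow hπ hN hq hclose hper
  refine ⟨e, rfl, fun v hv => ?_⟩
  have hdvd := pow_dvd_iff_le_of_addVal_eq hπ hv
  have hv1 : 1 ≤ v := (hdvd 1).mp (by simpa using hpπ)
  have hv2 : π ^ v ∣ (p : R) := (hdvd v).mpr le_rfl
  have hv3 : ¬ π ^ (v + 1) ∣ (p : R) := fun h => by have := (hdvd _).mp h; omega
  have hc : IsCloseToId ε π σ 1 1 := by simpa using hclose 1
  -- the point has exact period `p` under `σ ^ p ^ (e - 1)`
  have hne : ∀ k, e = k + 1 → ε.comp (σ ^ p ^ k) ≠ ε := by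
    rintro k rfl h
    rw [hper, Nat.pow_dvd_pow_iff_le_right hp.one_lt] at h
    omega
  have heq : ε.comp (σ ^ p ^ e) = ε := (hper _).mpr dvd_rfl
  refine ⟨fun hp2 => le_one_add_logb_two hv1 ?_, fun hp2 => le_one_add_logb_goldenRatio hv1 ?_⟩
  · intro k hk
    exact hc.two_pow_le hπ hp hp2 hv1 hv2 hv3 (hne k hk) (hk ▸ heq)
  · intro k hk
    subst hp2
    exact hc.fib_le hπ hv1 hv2 hv3 (hne k hk) (hk ▸ heq)

end DVR

/-! ### Periods of the section, of its reduction, and on the cotangent space -/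

lemma primitivePeriod_dvd_iff {X T : Scheme.{u}} (φ : X ⟶ X) (P : T ⟶ X) (i : ℕ) :
    primitivePeriod φ P ∣ i ↔ iteratePoint φ P i = P :=
  Function.isPeriodicPt_iff_minimalPeriod_dvd.symm

lemma iteratePoint_comp {X Y T : Scheme.{u}} (φ : X ⟶ X) (ψ : Y ⟶ Y) (g : X ⟶ Y)
    (h : φ ≫ g = g ≫ ψ) (P : T ⟶ X) (i : ℕ) :
    iteratePoint φ P i ≫ g = iteratePoint ψ (P ≫ g) i := by
  rw [← comp_iterateHom, ← comp_iterateHom, Category.assoc, iterateHom_comp _ _ _ h,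
    Category.assoc]

lemma iterateHom_comp_toSpec {X Y : Scheme.{u}} (φ : X ⟶ X) (f : X ⟶ Y) (hφ : φ ≫ f = f) (i : ℕ) :
    iterateHom φ i ≫ f = f := by
  induction i with
  | zero => exact Category.id_comp _
  | succ i ih => rw [iterateHom_succ, Category.assoc, hφ, ih]

section
variable {R : Type u} [CommRing R] {X : Scheme.{u}} (f : X ⟶ Spec (.of R)) (φ : X ⟶ X)
  (P : Spec (.of R) ⟶ X)

lemma reducedPeriod_dvd [IsLocalRing R] (hφ : φ ≫ f = f) (hP : P ≫ f = 𝟙 _) {n : ℕ}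
    (hn : iteratePoint φ P n = P) : reducedPeriod f φ hφ P hP ∣ n := by
  rw [reducedPeriod, primitivePeriod_dvd_iff]
  apply (isPullback_specialFibre f).hom_ext
  · rw [iteratePoint_comp _ φ _ (specialFibreMap_fst f f φ hφ), reduction_fst, ← comp_iterateHom,
      Category.assoc, comp_iterateHom, hn]
  · rw [← comp_iterateHom, Category.assoc,
      iterateHom_comp_toSpec _ _ (specialFibreMap_snd f f φ hφ)]

lemma iterateHom_orbitMap_eq_id [IsSeparated f] (hφ : φ ≫ f = f) (hP : P ≫ f = 𝟙 _) {n : ℕ}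
    (hn : iteratePoint φ P n = P) : iterateHom (orbitMap φ P) n = 𝟙 _ := by
  rw [← cancel_mono (orbitInclusion φ P), iterateHom_comp _ _ _ (orbitMap_inclusion φ P),
    Category.id_comp]
  refine orbitInclusion_comp_eq_of_forall f φ P hP hφ _ (iterateHom_comp_toSpec _ _ hφ n)
    fun i => ?_
  rw [← comp_iterateHom, Category.assoc, ← iterateHom_add, add_comm, iterateHom_add,
    ← Category.assoc, comp_iterateHom φ P n, hn]

lemma orbitPoint_comp_iterateHom_eq_iff (i : ℕ) :
    orbitPoint φ P ≫ iterateHom (orbitMap φ P) i = orbitPoint φ P ↔ primitivePeriod φ P ∣ i := by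
  rw [← cancel_mono (orbitInclusion φ P), Category.assoc,
    iterateHom_comp _ _ _ (orbitMap_inclusion φ P), ← Category.assoc, orbitPoint_inclusion,
    primitivePeriod_dvd_iff, comp_iterateHom]

end

instance (R : Type u) [CommRing R] (N : ℕ) : IsSeparated (projectiveSpaceToSpec R N) := by
  unfold projectiveSpaceToSpec
  infer_instance

end GoodReduction

end

open GoodReduction in
theorem mainTheorem2
    {R : Type u} [CommRing R] [IsDomain R] [IsDiscreteValuationRing R]
    [IsAdicComplete (IsLocalRing.maximalIdeal R) R]
    [Finite (IsLocalRing.ResidueField R)]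
    (p : ℕ) [CharP (IsLocalRing.ResidueField R) p]
    {K : Type u} [Field K] [Algebra R K] [IsFractionRing R K]
    -- `X` is an integral scheme over `K` of dimension `d`
    {X : Scheme.{u}} [IsIntegral X] (s : X ⟶ Spec (.of K))
    (d : ℕ) (hd : topologicalKrullDim X = d)
    -- `𝒳` is a smooth closed subscheme of `ℙ^N_R` with generic fibre `X`
    {𝒳 : Scheme.{u}} (N : ℕ) (ι : 𝒳 ⟶ GoodReduction.projectiveSpace R N) [IsClosedImmersion ι]
    (f : 𝒳 ⟶ Spec (.of R)) (hf : ι ≫ GoodReduction.projectiveSpaceToSpec R N = f) [Smooth f]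
    (j : X ⟶ 𝒳) (hj : IsPullback j s f (Spec.map (CommRingCat.ofHom (algebraMap R K))))
    -- an `R`-morphism `φ` and a periodic section `P` of primitive period `n`
    (φ : 𝒳 ⟶ 𝒳) (hφ : φ ≫ f = f)
    (P : Spec (.of R) ⟶ 𝒳) (hP : P ≫ f = 𝟙 _)
    (n : ℕ) (hn : 0 < n) (hPn : GoodReduction.primitivePeriod φ P = n) :
    ∃ e : ℕ,
      n = GoodReduction.reducedPeriod f φ hφ P hP *
        GoodReduction.cotangentOrder f φ hφ P hP * p ^ e ∧
      ∀ v : ℕ, IsDiscreteValuationRing.addVal R (p : R) = (v : ℕ∞) →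
        (p ≠ 2 → (e : ℝ) ≤ 1 + Real.logb 2 v) ∧
        (p = 2 → (e : ℝ) ≤ 1 + Real.logb ((1 + Real.sqrt 5) / 2)
          ((Real.sqrt 5 * v + Real.sqrt (5 * (v : ℝ) ^ 2 + 4)) / 2)) := by
  have hsep : IsSeparated f := hf ▸ inferInstance
  have hp : p.Prime := CharP.char_is_prime (IsLocalRing.ResidueField R) p
  obtain ⟨π, hπ⟩ := IsDiscreteValuationRing.exists_irreducible R
  have hmax := hπ.maximalIdeal_eq
  -- `p` is the only prime number that is not a unit in `R`
  have hdvd : ∀ q : ℕ, π ∣ (q : R) ↔ p ∣ q := by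
    intro q
    rw [← Ideal.mem_span_singleton, ← hmax, ← IsLocalRing.residue_eq_zero_iff, map_natCast,
      CharP.cast_eq_zero_iff (IsLocalRing.ResidueField R) p]
  have hPn' : iteratePoint φ P n = P := (primitivePeriod_dvd_iff φ P n).mp hPn.dvd
  obtain ⟨M, hM⟩ : reducedPeriod f φ hφ P hP ∣ n := reducedPeriod_dvd f φ P hφ hP hPn'
  set m := reducedPeriod f φ hφ P hP with hm
  have hm0 : 0 < m := Nat.pos_of_ne_zero fun h => hn.ne' (by rw [hM, h, zero_mul])
  have hM0 : M ≠ 0 := fun h => hn.ne' (by rw [hM, h, mul_zero])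
  set ψ := iterateHom (orbitMap φ P) m with hψ
  have hρ : orbitReturnMap f φ hφ P hP ≫ specialFibreFst (orbitToSpec f φ P) =
      specialFibreFst (orbitToSpec f φ P) ≫ ψ :=
    iterateHom_comp _ _ _ (specialFibreMap_fst _ _ _ _) m
  obtain ⟨r', hr'⟩ : cotangentOrder f φ hφ P hP ∣ M := by
    refine orderOf_dvd_of_pow_eq_one (cotangentMap_pow_eq_one _ ψ _ hρ _ _ M ?_)
    rw [hψ, ← iterateHom_mul, ← hM]
    exact iterateHom_orbitMap_eq_id f φ P hφ hP hPn'
  obtain ⟨A, _, _, ε, σ, hper, hclose⟩ := exists_isCloseToId (orbitToSpec f φ P) (orbitPoint φ P)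
    (orbitPoint_toSpec f φ P hP) ψ (iterateHom_comp_toSpec _ _ (orbitMap_toSpec f φ hφ P) m)
    (orbitReturnMap f φ hφ P hP) hρ (orbitReducedPoint f φ P hP)
    (orbitReturnMap_reducedPoint f φ hφ P hP) (by
      refine congr($(reduction_fst (orbitToSpec f φ P) (orbitPoint φ P)
        (orbitPoint_toSpec f φ P hP)) (IsLocalRing.closedPoint _)).trans ?_
      have : (specResidue R) (IsLocalRing.closedPoint (IsLocalRing.ResidueField R)) =
        IsLocalRing.closedPoint R :=
        have : IsLocalHom (CommRingCat.ofHom (IsLocalRing.residue R)).hom :=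
          inferInstanceAs (IsLocalHom (IsLocalRing.residue R))
        Spec_closedPoint (f := CommRingCat.ofHom (IsLocalRing.residue R))
      exact congr((orbitPoint φ P) $this))
  set r := cotangentOrder f φ hφ P hP with hr
  have hr0 : 0 < r := Nat.pos_of_ne_zero fun h => hM0 (by rw [hr', h, zero_mul])
  -- `r' = n / (m r)` is the period of `P` under `φ ^ (m r)`, which acts on `A` as `σ ^ r`
  obtain ⟨e, he, hbound⟩ := exists_period_eq_prime_pow_and_bound (ε := ε) (σ := σ ^ r) hπ hp
    (N := r') (fun h => hM0 (by rw [hr', h, mul_zero])) ((hdvd p).mpr dvd_rfl)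
    (fun q hq hπq => ((Nat.prime_dvd_prime_iff_eq hp hq).mp ((hdvd q).mp hπq)).symm)
    (fun k => by
      -- every power of `σ ^ r` is trivial on the cotangent space
      rw [← pow_mul]
      refine hclose π hmax _ ?_
      rw [pow_mul]
      exact (congr($(pow_orderOf_eq_one (orbitCotangentMap f φ hφ P hP)) ^ k)).trans (one_pow k))
    (fun k => by
      rw [← pow_mul, hper, hψ, ← iterateHom_mul, orbitPoint_comp_iterateHom_eq_iff, hPn, hM, hr',
        Nat.mul_dvd_mul_iff_left hm0, Nat.mul_dvd_mul_iff_left hr0])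
  exact ⟨e, by rw [hM, hr', he, mul_assoc], hbound⟩
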